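/- A graph is planar if it can be drawn in the Euclidean plane with its vertices as distinct points and its edges as simple arcs joining their ends, so that no arc contains a vertex other than its two ends and any two arcs meet only in common ends. For positive integers $n$ and $k \ge 3$, let $\mathrm{ex}_{\mathcal P}(n, C_k)$ denote the maximum number of edges of a simple planar graph on $n$ vertices that contains no cycle of length $k$ as a (not necessarily induced) subgraph. Then for every integer $k \ge 7$ there is an $n_0 = n_0(k)$ such that for all integers $n \ge n_0$, $$\mathrm{ex}_{\mathcal P}(n, C_k) \;\ge\; 3n - 6 - \frac{6\cdot 3^{\log_2 3}\, n}{k^{\log_2 3}}.$$ -/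

import Mathlib

namespace SimpleGraph

/-- A graph is planar if it can be drawn in the Euclidean plane: distinct vertices `v` are distinct
points `p v`, every edge `e` with ends `u`, `v` is a simple (injective) continuous arc `A e` from
`p u` to `p v`, an arc contains no vertex other than its two ends, and two different arcs
meet only in vertices (hence only in common ends). -/
def IsPlanar {V : Type*} (G : SimpleGraph V) : Prop :=
  ∃ (p : V → EuclideanSpace ℝ (Fin 2)) (A : Sym2 V → Set (EuclideanSpace ℝ (Fin 2))),
    Function.Injective p ∧
    (∀ u v, G.Adj u v →
      ∃ γ : _root_.Path (p u) (p v), Function.Injective γ ∧ Set.range γ = A s(u, v)) ∧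
    (∀ e ∈ G.edgeSet, ∀ w, p w ∈ A e → w ∈ e) ∧
    (∀ e ∈ G.edgeSet, ∀ f ∈ G.edgeSet, e ≠ f → A e ∩ A f ⊆ Set.range p)

open scoped Classical in
/-- The planar Turán number: the maximum number of edges of a planar graph on `n` vertices that
contains no copy of `H` as a (not necessarily induced) subgraph. -/
noncomputable def planarTuranNumber (n : ℕ) {W : Type*} (H : SimpleGraph W) : ℕ :=
  Finset.sup {G : SimpleGraph (Fin n) | G.IsPlanar ∧ H.Free G} (fun G => G.edgeFinset.card)

end SimpleGraph

namespace StraightLineComplex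

open scoped Classical

/-! The construction glues many copies of one plane triangulation at a common vertex and fills up
`n` with isolated points. A triangulated block loses nothing locally, so with `t` further vertices
per block the loss against `3n` is about `3n / t`; the task is to make `t` large while every cycle
stays shorter than `k`. The shared vertex is a cut vertex, so each cycle lives in one block.

A block starts as a triangulation on `s + 3` vertices with `2s + 1` inner faces (`s = 1` is K₄, `s =
2` has five vertices), and all inner faces are starred `j` times. Starring triples the number of
faces but at most doubles the longest cycle (`IsComplex.cycleBound_subdivide`): new vertices are
pairwise nonadjacent, so they make up at most half of a cycle, and each has pairwise adjacent
neighbours, so it can be bypassed. Cycles thus have at most `2 ^ j * (s + 3)` vertices, while `2t =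
(2s + 1) * 3 ^ j + 3`; this is where the exponent `log₂ 3` comes from. The two values of `s`
together cover all `k` between consecutive powers of two with the stated constant.

Planarity comes from geometry: every stage is a simplicial complex in the plane with disjoint open
cells, so its one-skeleton is a straight-line drawing. -/

lemma finset_nonempty_of_ssubset {E : Type*} {s T : Finset E} (hT : T ⊂ s) : s.Nonempty :=
  (Finset.exists_of_ssubset hT).imp fun _ h => h.1

/-! ### Starring triangles of a geometric complex at their barycenters -/

section General

variable {E : Type*} [AddCommGroup E] [Module ℝ E]

/-- The relative interior of the convex hull of an affinely independent finite set. -/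
def openCell (s : Finset E) : Set E :=
  {x | ∃ w : E → ℝ, (∀ p ∈ s, 0 < w p) ∧ ∑ p ∈ s, w p = 1 ∧ ∑ p ∈ s, w p • p = x}

/-- Affine independence of a finite set, in terms of weights. -/
def BaryIndep (s : Finset E) : Prop :=
  ∀ w : E → ℝ, ∑ p ∈ s, w p = 0 → ∑ p ∈ s, w p • p = 0 → ∀ p ∈ s, w p = 0

/-- A finite geometric simplicial complex of dimension at most two, given by its simplices. -/
structure IsComplex (K : Finset (Finset E)) : Prop where
  nonempty : ∀ s ∈ K, s.Nonempty
  card_le : ∀ s ∈ K, s.card ≤ 3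
  down : ∀ s ∈ K, ∀ t ⊆ s, t.Nonempty → t ∈ K
  indep : ∀ s ∈ K, BaryIndep s
  cell_inj : ∀ s ∈ K, ∀ t ∈ K, ∀ x, x ∈ openCell s → x ∈ openCell t → s = t

/-- The barycenter of a finite set. -/
noncomputable def bary (s : Finset E) : E := (s.card : ℝ)⁻¹ • ∑ p ∈ s, p

/-- The simplices that replace `s` when `s` is starred at its barycenter. -/
noncomputable def star (s : Finset E) : Finset (Finset E) := s.ssubsets.image (insert (bary s))

/-- The complex obtained from `K` by starring every simplex in `A` at its barycenter. -/
noncomputable def subdivide (K A : Finset (Finset E)) : Finset (Finset E) :=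
  (K \ A) ∪ A.biUnion star

/-- Weights on `s` equivalent to given weights on `insert (bary s) T`, where `T ⊂ s`. -/
noncomputable def pushWeight (s T : Finset E) (w : E → ℝ) (p : E) : ℝ :=
  (s.card : ℝ)⁻¹ * w (bary s) + if p ∈ T then w p else 0

/-- The weight at the barycenter is shared equally among the vertices of `s`, which preserves both
the total weight and, in the next lemma, the weighted sum of points. -/
lemma sum_pushWeight {s T : Finset E} (hT : T ⊂ s) (hb : bary s ∉ s) (w : E → ℝ) :
    ∑ p ∈ s, pushWeight s T w p = ∑ p ∈ insert (bary s) T, w p := by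
  have hs : (s.card : ℝ) ≠ 0 := by
    have : s.Nonempty := (finset_nonempty_of_ssubset hT)
    exact_mod_cast this.card_pos.ne'
  rw [Finset.sum_insert (fun h => hb (hT.1 h))]
  simp only [pushWeight, Finset.sum_add_distrib, Finset.sum_const, nsmul_eq_mul]
  rw [← Finset.sum_filter, Finset.filter_mem_eq_inter, Finset.inter_eq_right.2 hT.1]
  field_simp

lemma sum_pushWeight_smul {s T : Finset E} (hT : T ⊂ s) (hb : bary s ∉ s) (w : E → ℝ) :
    ∑ p ∈ s, pushWeight s T w p • p = ∑ p ∈ insert (bary s) T, w p • p := by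
  rw [Finset.sum_insert (fun h => hb (hT.1 h))]
  simp only [pushWeight, add_smul, Finset.sum_add_distrib, ite_smul, zero_smul]
  rw [← Finset.sum_filter, Finset.filter_mem_eq_inter, Finset.inter_eq_right.2 hT.1]
  congr 1
  rw [← Finset.smul_sum, bary, smul_smul, mul_comm]

lemma self_mem_openCell (x : E) : x ∈ openCell {x} := ⟨fun _ => 1, by simp⟩

lemma bary_mem_openCell {s : Finset E} (hs : s.Nonempty) : bary s ∈ openCell s := by
  have h : (0 : ℝ) < s.card := by exact_mod_cast hs.card_pos
  refine ⟨fun _ => (s.card : ℝ)⁻¹, fun _ _ => by positivity, ?_, ?_⟩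
  · simp [h.ne']
  · rw [bary, Finset.smul_sum]

lemma openCell_insert_bary_subset {s T : Finset E} (hT : T ⊂ s) (hb : bary s ∉ s) :
    openCell (insert (bary s) T) ⊆ openCell s := by
  rintro x ⟨w, hw, h1, hx⟩
  refine ⟨pushWeight s T w, fun p _ => ?_, by rw [sum_pushWeight hT hb, h1],
    by rw [sum_pushWeight_smul hT hb, hx]⟩
  have hs : (0 : ℝ) < s.card := by exact_mod_cast (finset_nonempty_of_ssubset hT).card_pos
  have h := hw _ (Finset.mem_insert_self _ _)
  unfold pushWeight
  have : 0 ≤ if p ∈ T then w p else 0 := by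
    split_ifs with hp
    · exact (hw p (Finset.mem_insert_of_mem hp)).le
    · rfl
  positivity

lemma BaryIndep.weights_eq {s : Finset E} (hs : BaryIndep s) {w w' : E → ℝ}
    (h : ∑ p ∈ s, w p = ∑ p ∈ s, w' p) (h' : ∑ p ∈ s, w p • p = ∑ p ∈ s, w' p • p) :
    ∀ p ∈ s, w p = w' p := by
  intro p hp
  have := hs (fun p => w p - w' p) (by simp [h]) (by simp [sub_smul, h']) p hp
  linarith

lemma BaryIndep.insert_bary {s T : Finset E} (hs : BaryIndep s) (hT : T ⊂ s) (hb : bary s ∉ s) :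
    BaryIndep (insert (bary s) T) := by
  intro w h1 h2
  have key := hs (pushWeight s T w) (by rw [sum_pushWeight hT hb, h1])
    (by rw [sum_pushWeight_smul hT hb, h2])
  have hc : (0 : ℝ) < s.card := by exact_mod_cast (finset_nonempty_of_ssubset hT).card_pos
  -- At a vertex outside `T` the pushed weight is only the share of the barycenter, so that share
  -- vanishes.
  obtain ⟨q, hq, hqT⟩ := Finset.exists_of_ssubset hT
  have h0 : w (bary s) = 0 := by
    have := key q hq
    simpa [pushWeight, hqT, hc.ne'] using this
  intro p hp
  rcases Finset.mem_insert.1 hp with rfl | hp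
  · exact h0
  · have := key p (hT.1 hp)
    simpa [pushWeight, hp, h0] using this

/-- The pushed weights on `s` are determined by `x`. Their minimum is the barycenter's share,
attained exactly off `T`, so `T` is recovered as the set where the weight exceeds the minimum. -/
lemma BaryIndep.insert_bary_inj {s T T' : Finset E} (hs : BaryIndep s) (hT : T ⊂ s) (hT' : T' ⊂ s)
    (hb : bary s ∉ s) {x : E} (hx : x ∈ openCell (insert (bary s) T))
    (hx' : x ∈ openCell (insert (bary s) T')) : T = T' := by
  obtain ⟨w, hw, h1, h2⟩ := hx
  obtain ⟨w', hw', h1', h2'⟩ := hx'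
  have key := hs.weights_eq (w := pushWeight s T w) (w' := pushWeight s T' w')
    (by rw [sum_pushWeight hT hb, sum_pushWeight hT' hb, h1, h1'])
    (by rw [sum_pushWeight_smul hT hb, sum_pushWeight_smul hT' hb, h2, h2'])
  have hp : ∀ p ∈ T, 0 < w p := fun p hp => hw p (Finset.mem_insert_of_mem hp)
  have hp' : ∀ p ∈ T', 0 < w' p := fun p hp => hw' p (Finset.mem_insert_of_mem hp)
  obtain ⟨q, hq, hqT⟩ := Finset.exists_of_ssubset hT
  obtain ⟨q', hq', hqT'⟩ := Finset.exists_of_ssubset hT'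
  have e1 := key q hq
  have e2 := key q' hq'
  simp only [pushWeight, hqT, hqT', if_false, add_zero] at e1 e2 key
  have f1 : 0 ≤ if q ∈ T' then w' q else 0 := by
    split_ifs with h
    · exact (hp' q h).le
    · rfl
  have f2 : 0 ≤ if q' ∈ T then w q' else 0 := by
    split_ifs with h
    · exact (hp q' h).le
    · rfl
  have e : (s.card : ℝ)⁻¹ * w (bary s) = (s.card : ℝ)⁻¹ * w' (bary s) := by linarith
  ext p
  constructor
  · intro h
    by_contra h'
    have := key p (hT.1 h)
    simp only [h, h', if_true, if_false] at this
    linarith [hp p h]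
  · intro h
    by_contra h'
    have := key p (hT'.1 h)
    simp only [h, h', if_true, if_false] at this
    linarith [hp' p h]

lemma mem_star {s t : Finset E} : t ∈ star s ↔ ∃ T, T ⊂ s ∧ insert (bary s) T = t := by
  simp [star]

lemma mem_subdivide {K A : Finset (Finset E)} {t : Finset E} :
    t ∈ subdivide K A ↔ (t ∈ K ∧ t ∉ A) ∨ ∃ s ∈ A, ∃ T, T ⊂ s ∧ insert (bary s) T = t := by
  simp [subdivide, mem_star]

namespace IsComplex

variable {K A : Finset (Finset E)}

lemma singleton_mem (hK : IsComplex K) {s : Finset E} (hs : s ∈ K) {p : E} (hp : p ∈ s) :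
    {p} ∈ K :=
  hK.down s hs _ (by simpa using hp) (by simp)

lemma pair_mem (hK : IsComplex K) {s : Finset E} (hs : s ∈ K) {p q : E} (hp : p ∈ s) (hq : q ∈ s) :
    {p, q} ∈ K :=
  hK.down s hs _ (by simp [Finset.insert_subset_iff, hp, hq]) (by simp)

lemma singleton_bary_notMem (hK : IsComplex K) {s : Finset E} (hs : s ∈ K) (hc : s.card = 3) :
    {bary s} ∉ K := by
  intro h
  have := hK.cell_inj s hs _ h _ (bary_mem_openCell (hK.nonempty s hs)) (self_mem_openCell _)
  rw [this] at hc
  simp at hc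

lemma bary_notMem (hK : IsComplex K) {s t : Finset E} (hs : s ∈ K) (hc : s.card = 3) (ht : t ∈ K) :
    bary s ∉ t :=
  fun h => hK.singleton_bary_notMem hs hc (hK.singleton_mem ht h)

lemma eq_of_mem_openCell_insert (hK : IsComplex K) {s t T : Finset E} (hs : s ∈ K)
    (hc : s.card = 3) (ht : t ∈ K) (hT : T ⊂ s) {x : E} (hx : x ∈ openCell (insert (bary s) T))
    (hx' : x ∈ openCell t) : s = t :=
  hK.cell_inj s hs t ht x
    (openCell_insert_bary_subset hT (hK.bary_notMem hs hc hs) hx) hx'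

lemma bary_inj (hK : IsComplex K) {s t : Finset E} (hs : s ∈ K) (ht : t ∈ K)
    (h : bary s = bary t) : s = t :=
  hK.cell_inj s hs t ht _ (bary_mem_openCell (hK.nonempty s hs))
    (h ▸ bary_mem_openCell (hK.nonempty t ht))

/-- Each new open cell lies inside the open cell of the triangle it came from. A collision of cells
therefore happens within a single starred triangle, where `insert_bary_inj` applies. -/
lemma subdivide (hK : IsComplex K) (hA : A ⊆ K) (h3 : ∀ s ∈ A, s.card = 3) :
    IsComplex (subdivide K A) where
  nonempty := by
    intro t ht
    rcases mem_subdivide.1 ht with ⟨h, -⟩ | ⟨s, hs, T, hT, rfl⟩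
    · exact hK.nonempty t h
    · simp
  card_le := by
    intro t ht
    rcases mem_subdivide.1 ht with ⟨h, -⟩ | ⟨s, hs, T, hT, rfl⟩
    · exact hK.card_le t h
    · have h1 := Finset.card_insert_le (bary s) T
      have h2 := Finset.card_lt_card hT
      have := h3 s hs
      omega
  down := by
    intro t ht u hu hne
    rcases mem_subdivide.1 ht with ⟨h, hA'⟩ | ⟨s, hs, T, hT, rfl⟩
    · refine mem_subdivide.2 (.inl ⟨hK.down t h u hu hne, fun huA => ?_⟩)
      have := Finset.eq_of_subset_of_card_le hu (by rw [h3 u huA]; exact hK.card_le t h)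
      exact hA' (this ▸ huA)
    · by_cases hb : bary s ∈ u
      · refine mem_subdivide.2 (.inr ⟨s, hs, u.erase (bary s), ?_, Finset.insert_erase hb⟩)
        refine lt_of_le_of_lt ?_ hT
        intro x hx
        rw [Finset.mem_erase] at hx
        exact (Finset.mem_insert.1 (hu hx.2)).resolve_left hx.1
      · have hus : u ⊂ s := lt_of_le_of_lt ((Finset.subset_insert_iff_of_notMem hb).1 hu) hT
        refine mem_subdivide.2 (.inl ⟨hK.down s (hA hs) u hus.1 hne, fun huA => ?_⟩)
        have := Finset.card_lt_card hus
        rw [h3 u huA, h3 s hs] at this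
        exact lt_irrefl _ this
  indep := by
    intro t ht
    rcases mem_subdivide.1 ht with ⟨h, -⟩ | ⟨s, hs, T, hT, rfl⟩
    · exact hK.indep t h
    · exact (hK.indep s (hA hs)).insert_bary hT (hK.bary_notMem (hA hs) (h3 s hs) (hA hs))
  cell_inj := by
    intro t ht u hu x hx hx'
    rcases mem_subdivide.1 ht with ⟨h, htA⟩ | ⟨s, hs, T, hT, rfl⟩ <;>
    rcases mem_subdivide.1 hu with ⟨h', huA⟩ | ⟨s', hs', T', hT', rfl⟩
    · exact hK.cell_inj t h u h' x hx hx'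
    · cases hK.eq_of_mem_openCell_insert (hA hs') (h3 _ hs') h hT' hx' hx
      exact absurd hs' htA
    · cases hK.eq_of_mem_openCell_insert (hA hs) (h3 _ hs) h' hT hx hx'
      exact absurd hs huA
    · have hb' := hK.bary_notMem (hA hs') (h3 _ hs') (hA hs')
      cases hK.eq_of_mem_openCell_insert (hA hs) (h3 _ hs) (hA hs') hT hx
        (openCell_insert_bary_subset hT' hb' hx')
      rw [(hK.indep s (hA hs)).insert_bary_inj hT hT' hb' hx hx']

end IsComplex

end General

/-! ### Cycles as cyclic lists, and the removal of new vertices -/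

section Cyclic

variable {α : Type*}

lemma chain_coe_of_forall_mem {r r' : α → α → Prop} {l : List α}
    (h : ∀ a ∈ l, ∀ b ∈ l, r a b → r' a b) (hl : Cycle.Chain r (l : Cycle α)) :
    Cycle.Chain r' (l : Cycle α) := by
  cases l with
  | nil => exact Cycle.Chain.nil _
  | cons a t =>
    rw [Cycle.chain_coe_cons] at hl ⊢
    refine hl.imp_of_mem_imp ?_
    intro x y hx hy hxy
    exact h x (by simpa [or_comm, or_assoc] using hx) y (by simpa [or_comm, or_assoc] using hy) hxy

lemma countP_le_of_isChain {r : α → α → Prop} {N : α → Prop}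
    (hN : ∀ a b, r a b → N a → ¬ N b) :
    ∀ (t : List α) (a : α), (a :: t).IsChain r →
      t.countP (fun x => N x) + (if N a then 1 else 0) ≤ t.countP (fun x => ¬ N x) + 1 := by
  intro t
  induction t with
  | nil => intro a _; simp; split_ifs <;> simp
  | cons b t ih =>
    intro a h
    rw [List.isChain_cons_cons] at h
    have := ih b h.2
    have h' := hN a b h.1
    by_cases ha : N a <;> by_cases hb : N b <;> simp_all
    omega

/-- With the cycle rotated to start outside `N`, the path bound has no excess left: the starting
vertex pays for the `+ 1`. -/
lemma countP_le_of_cyclic {r : α → α → Prop} {N : α → Prop}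
    (hirr : ∀ a, ¬ r a a) (hN : ∀ a b, r a b → N a → ¬ N b)
    {l : List α} (hl : Cycle.Chain r (l : Cycle α)) :
    l.countP (fun x => N x) ≤ l.countP (fun x => ¬ N x) := by
  by_cases hold : ∃ a ∈ l, ¬ N a
  · obtain ⟨a, ha, hNa⟩ := hold
    obtain ⟨n, t, hr⟩ : ∃ n t, l.rotate n = a :: t := by
      obtain ⟨s, t, rfl⟩ := List.append_of_mem ha
      exact ⟨s.length, t ++ s, by simp⟩
    have hp : (a :: t).Perm l := hr ▸ List.rotate_perm l n
    have hc : (l : Cycle α) = (a :: t : List α) := Cycle.coe_eq_coe.2 ⟨n, hr⟩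
    rw [hc, Cycle.chain_coe_cons] at hl
    have h := countP_le_of_isChain hN t a (by
      rw [← List.cons_append] at hl
      exact (List.isChain_append.1 hl).1)
    rw [← hp.countP_eq, ← hp.countP_eq]
    simp_all
  · push Not at hold
    cases l with
    | nil => simp
    | cons a t =>
      rw [Cycle.chain_coe_cons] at hl
      cases t with
      | nil => simp [hirr] at hl
      | cons b t =>
        simp only [List.cons_append, List.isChain_cons_cons] at hl
        exact absurd (hold b (by simp)) (hN a b hl.1 (hold a (by simp)))

/-- If the neighbours of every vertex in `N` are pairwise adjacent, then the vertices in `N` can be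
cut out of a cycle. -/
lemma countP_old_le {r r₀ : α → α → Prop} {N : α → Prop} {c : ℕ} (hc : 1 ≤ c)
    (hsymm : ∀ a b, r a b → r b a)
    (hr₀ : ∀ a b, r a b → ¬ N a → ¬ N b → r₀ a b)
    (htri : ∀ v a b, N v → r v a → r v b → a ≠ b → r a b)
    (hbound : ∀ l : List α, l.Nodup → Cycle.Chain r₀ (l : Cycle α) → l.length ≤ c)
    (m : ℕ) : ∀ l : List α, l.length = m → l.Nodup → Cycle.Chain r (l : Cycle α) →
      l.countP (fun x => ¬ N x) ≤ c := by
  induction m with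
  | zero =>
    intro l hm _ _
    rw [List.length_eq_zero_iff] at hm
    simp [hm]
  | succ m ih =>
    intro l hm hnd hl
    by_cases hnew : ∃ v ∈ l, N v
    · obtain ⟨v, hv, hNv⟩ := hnew
      obtain ⟨n, t, hr⟩ : ∃ n t, l.rotate n = v :: t := by
        obtain ⟨s, t, rfl⟩ := List.append_of_mem hv
        exact ⟨s.length, t ++ s, by simp⟩
      have hp : (v :: t).Perm l := hr ▸ List.rotate_perm l n
      have hcy : (l : Cycle α) = (v :: t : List α) := Cycle.coe_eq_coe.2 ⟨n, hr⟩
      rw [hcy, Cycle.chain_coe_cons] at hl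
      rw [← hp.countP_eq]
      have hlen : t.length = m := by simpa [hm] using hp.length_eq
      have hnd' := hp.nodup_iff.2 hnd
      have hcount : (v :: t).countP (fun x => ¬ N x) = t.countP (fun x => ¬ N x) := by
        simp [hNv]
      rw [hcount]
      cases t with
      | nil => simp
      | cons x t =>
        rcases List.eq_nil_or_concat t with rfl | ⟨t', z, rfl⟩
        -- Deleting `v` leaves a single vertex, which is not a cyclic chain in general, so induction
        -- is unavailable and `1 ≤ c` is used directly.
        · exact (List.countP_le_length).trans (by simpa using hc)
        · refine ih _ hlen (List.nodup_cons.1 hnd').2 ?_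
          rw [Cycle.chain_coe_cons]
          simp only [List.cons_append, List.isChain_cons_cons] at hl
          obtain ⟨hvx, hl⟩ := hl
          rw [← List.cons_append, List.isChain_append] at hl ⊢
          refine ⟨hl.1, by simp, ?_⟩
          have hz := hl.2.2 z (by simp [List.getLast?_cons]) v (by simp)
          intro a ha b hb
          have ha' : a = z := by simpa [List.getLast?_cons, eq_comm] using ha
          have hb' : b = x := by simpa [eq_comm] using hb
          subst ha' hb'
          -- The two neighbours of `v` on the cycle are adjacent, so the cycle closes up without
          -- `v`.
          refine htri v _ _ hNv (hsymm _ _ hz) hvx ?_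
          rintro rfl
          simp at hnd'
    · push Not at hnew
      refine List.countP_le_length.trans (hbound l hnd (chain_coe_of_forall_mem ?_ hl))
      exact fun a ha b hb h => hr₀ a b h (hnew a ha) (hnew b hb)

lemma length_le_of_countP {N : α → Prop} {l : List α} {c : ℕ}
    (h : l.countP (fun x => N x) ≤ l.countP (fun x => ¬ N x))
    (h' : l.countP (fun x => ¬ N x) ≤ c) : l.length ≤ 2 * c := by
  have := List.length_eq_countP_add_countP (fun x => decide (N x)) (l := l)
  simp only [decide_eq_true_eq] at this
  omega

end Cyclic

/-! ### Cycles in the one-skeleton -/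

section Skeleton

variable {E : Type*}

/-- Adjacency in the one-skeleton. -/
def Adj (K : Finset (Finset E)) (u v : E) : Prop := u ≠ v ∧ {u, v} ∈ K

lemma Adj.symm {K : Finset (Finset E)} {u v : E} (h : Adj K u v) : Adj K v u :=
  ⟨h.1.symm, Finset.pair_comm u v ▸ h.2⟩

/-- Every cycle of the one-skeleton has at most `c` vertices. -/
def CycleBound (K : Finset (Finset E)) (c : ℕ) : Prop :=
  ∀ l : List E, l.Nodup → Cycle.Chain (Adj K) (l : Cycle E) → l.length ≤ c

end Skeleton

/-! ### Simplex counts and cycle lengths under repeated starring -/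

section General

variable {E : Type*} [AddCommGroup E] [Module ℝ E]

/-- The simplices with `i + 1` vertices, one of them new, that starring `A` creates. -/
noncomputable def newSimplices (A : Finset (Finset E)) (i : ℕ) : Finset (Finset E) :=
  A.biUnion fun s => (s.powersetCard i).image (insert (bary s))

lemma mem_newSimplices {A : Finset (Finset E)} {i : ℕ} {t : Finset E} :
    t ∈ newSimplices A i ↔ ∃ s ∈ A, ∃ T, (T ⊆ s ∧ T.card = i) ∧ insert (bary s) T = t := by
  simp [newSimplices]

namespace IsComplex

variable {K A : Finset (Finset E)}

lemma newSimplices_subset (h3 : ∀ s ∈ A, s.card = 3) {i : ℕ} (hi : i ≤ 2) :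
    newSimplices A i ⊆ StraightLineComplex.subdivide K A := by
  intro t ht
  obtain ⟨s, hs, T, ⟨hT, hc⟩, rfl⟩ := mem_newSimplices.1 ht
  refine mem_subdivide.2 (.inr ⟨s, hs, T, Finset.ssubset_iff_subset_ne.2 ⟨hT, ?_⟩, rfl⟩)
  rintro rfl
  have := h3 _ hs
  omega

lemma card_of_mem_newSimplices (hK : IsComplex K) (hA : A ⊆ K) (h3 : ∀ s ∈ A, s.card = 3) {i : ℕ}
    {t : Finset E} (ht : t ∈ newSimplices A i) : t.card = i + 1 := by
  obtain ⟨s, hs, T, ⟨hT, hc⟩, rfl⟩ := mem_newSimplices.1 ht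
  rw [Finset.card_insert_of_notMem, hc]
  exact fun h => hK.bary_notMem (hA hs) (h3 s hs) (hA hs) (hT h)

lemma card_newSimplices (hK : IsComplex K) (hA : A ⊆ K) (h3 : ∀ s ∈ A, s.card = 3) {i : ℕ} :
    (newSimplices A i).card = A.card * Nat.choose 3 i := by
  have key : ∀ s ∈ A, ∀ s' ∈ A, ∀ T ⊆ s, ∀ T' ⊆ s', insert (bary s) T = insert (bary s') T' →
      s = s' := by
    intro s hs s' hs' T hT T' hT' h
    have : bary s ∈ insert (bary s') T' := h ▸ Finset.mem_insert_self _ _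
    rcases Finset.mem_insert.1 this with h | h
    · exact hK.bary_inj (hA hs) (hA hs') h
    · exact absurd (hT' h) (hK.bary_notMem (hA hs) (h3 _ hs) (hA hs'))
  rw [newSimplices, Finset.card_biUnion, Finset.sum_const_nat]
  · intro s hs
    rw [Finset.card_image_of_injOn, Finset.card_powersetCard, h3 s hs]
    intro T hT T' hT' h
    rw [Finset.mem_coe, Finset.mem_powersetCard] at hT hT'
    have hb := hK.bary_notMem (hA hs) (h3 s hs) (hA hs)
    rw [← Finset.erase_insert (fun h => hb (hT.1 h)), ← Finset.erase_insert (fun h => hb (hT'.1 h))]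
    exact congrArg (Finset.erase · (bary s)) h
  · intro s hs s' hs' hne
    rw [Function.onFun, Finset.disjoint_left]
    intro t ht ht'
    simp only [Finset.mem_image, Finset.mem_powersetCard] at ht ht'
    obtain ⟨T, hT, rfl⟩ := ht
    obtain ⟨T', hT', h⟩ := ht'
    exact hne (key s hs s' hs' T hT.1 T' hT'.1 h.symm)

/-- Only triangles are removed, so in the two lower cardinalities starring is purely additive. -/
lemma card_filter_subdivide (hK : IsComplex K) (hA : A ⊆ K) (h3 : ∀ s ∈ A, s.card = 3) {i : ℕ}
    (hi : i < 2) :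
    ((StraightLineComplex.subdivide K A).filter (fun s => s.card = i + 1)).card
      = (K.filter (fun s => s.card = i + 1)).card + A.card * Nat.choose 3 i := by
  have : (StraightLineComplex.subdivide K A).filter (fun s => s.card = i + 1)
      = K.filter (fun s => s.card = i + 1) ∪ newSimplices A i := by
    ext t
    simp only [Finset.mem_filter, Finset.mem_union]
    constructor
    · rintro ⟨ht, hc⟩
      rcases mem_subdivide.1 ht with ⟨h, -⟩ | ⟨s, hs, T, hT, rfl⟩
      · exact .inl ⟨h, hc⟩
      · refine .inr (mem_newSimplices.2 ⟨s, hs, T, ⟨hT.1, ?_⟩, rfl⟩)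
        rw [Finset.card_insert_of_notMem] at hc
        · omega
        · exact fun h => hK.bary_notMem (hA hs) (h3 s hs) (hA hs) (hT.1 h)
    · rintro (⟨h, hc⟩ | h)
      · refine ⟨mem_subdivide.2 (.inl ⟨h, fun hA' => ?_⟩), hc⟩
        have := h3 t hA'
        omega
      · exact ⟨newSimplices_subset h3 hi.le h, hK.card_of_mem_newSimplices hA h3 h⟩
  rw [this, Finset.card_union_of_disjoint, hK.card_newSimplices hA h3]
  rw [Finset.disjoint_left]
  intro t ht ht'
  obtain ⟨s, hs, T, -, rfl⟩ := mem_newSimplices.1 ht'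
  exact hK.bary_notMem (hA hs) (h3 s hs) (Finset.mem_filter.1 ht).1 (Finset.mem_insert_self _ _)

lemma mem_of_adj_bary (hK : IsComplex K) (hA : A ⊆ K) (h3 : ∀ s ∈ A, s.card = 3) {s : Finset E}
    (hs : s ∈ A) {u : E} (h : Adj (StraightLineComplex.subdivide K A) (bary s) u) : u ∈ s := by
  rcases mem_subdivide.1 h.2 with ⟨h', -⟩ | ⟨s', hs', T, hT, h'⟩
  · exact absurd (Finset.mem_insert_self _ _) (hK.bary_notMem (hA hs) (h3 s hs) h')
  · have h1 : bary s ∈ insert (bary s') T := h' ▸ Finset.mem_insert_self _ _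
    have h2 : u ∈ insert (bary s') T := by simp [h']
    rcases Finset.mem_insert.1 h1 with h1 | h1
    · cases hK.bary_inj (hA hs) (hA hs') h1
      exact hT.1 ((Finset.mem_insert.1 h2).resolve_left h.1.symm)
    · exact absurd (hT.1 h1) (hK.bary_notMem (hA hs) (h3 s hs) (hA hs'))

/-- Barycenters are adjacent only to vertices of their own triangle, so they are independent and
have pairwise adjacent neighbours. Bypassing them leaves at most `c` old vertices, and they are no
more numerous than those. -/
lemma cycleBound_subdivide (hK : IsComplex K) (hA : A ⊆ K) (h3 : ∀ s ∈ A, s.card = 3) {c : ℕ}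
    (hc : 1 ≤ c) (hb : CycleBound K c) :
    CycleBound (StraightLineComplex.subdivide K A) (2 * c) := by
  intro l hnd hl
  have hmem : ∀ s ∈ A, ∀ a ∈ s, a ∉ A.image bary := by
    intro s hs a ha h
    obtain ⟨s', hs', rfl⟩ := Finset.mem_image.1 h
    exact hK.bary_notMem (hA hs') (h3 _ hs') (hA hs) ha
  have h1 := countP_le_of_cyclic (N := fun x => x ∈ A.image bary) (fun a h => h.1 rfl) (by
    intro a b hab ha
    obtain ⟨s, hs, rfl⟩ := Finset.mem_image.1 ha
    exact hmem s hs b (hK.mem_of_adj_bary hA h3 hs hab)) hl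
  have h2 := countP_old_le (N := fun x => x ∈ A.image bary) hc (fun a b h => h.symm) (r₀ := Adj K)
    (by
      intro a b hab ha hb
      rcases mem_subdivide.1 hab.2 with ⟨h', -⟩ | ⟨s', hs', T, hT, h'⟩
      · exact ⟨hab.1, h'⟩
      · have : bary s' ∈ ({a, b} : Finset E) := h' ▸ Finset.mem_insert_self _ _
        have hs'' := Finset.mem_image_of_mem bary hs'
        rcases Finset.mem_insert.1 this with h | h
        · exact absurd (h ▸ hs'') ha
        · exact absurd (Finset.mem_singleton.1 h ▸ hs'') hb)
    (by
      intro v a b hv hva hvb hab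
      obtain ⟨s, hs, rfl⟩ := Finset.mem_image.1 hv
      have ha := hK.mem_of_adj_bary hA h3 hs hva
      have hb := hK.mem_of_adj_bary hA h3 hs hvb
      refine ⟨hab, mem_subdivide.2 (.inl ⟨hK.pair_mem (hA hs) ha hb, fun h => ?_⟩)⟩
      have := h3 _ h
      rw [Finset.card_pair hab] at this
      omega)
    hb _ l rfl hnd hl
  exact length_le_of_countP h1 h2

/-- Subdividing all faces of a family `d` times. -/
lemma exists_iterate_subdivide (d : ℕ) (hK : IsComplex K) (hA : A ⊆ K)
    (h3 : ∀ s ∈ A, s.card = 3) {c : ℕ} (hc : 1 ≤ c) (hb : CycleBound K c) :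
    ∃ K' : Finset (Finset E), IsComplex K' ∧ CycleBound K' (2 ^ d * c) ∧
      2 * (K'.filter (fun s => s.card = 1)).card + A.card
        = 2 * (K.filter (fun s => s.card = 1)).card + A.card * 3 ^ d ∧
      2 * (K'.filter (fun s => s.card = 2)).card + 3 * A.card
        = 2 * (K.filter (fun s => s.card = 2)).card + 3 * A.card * 3 ^ d := by
  induction d generalizing K A c with
  | zero => exact ⟨K, hK, by simpa using hb, by simp, by simp⟩
  | succ d ih =>
    -- The triangles just created, three per member of `A`, are the family to star next. The vertex
    -- gain is a geometric sum `A.card * (3 ^ d - 1) / 2`, and the edge gain is three times that.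
    obtain ⟨K', h1, h2, h3', h4⟩ := ih (hK.subdivide hA h3) (newSimplices_subset h3 le_rfl)
      (fun s hs => hK.card_of_mem_newSimplices hA h3 hs) (c := 2 * c) (by omega)
      (hK.cycleBound_subdivide hA h3 hc hb)
    refine ⟨K', h1, by rwa [pow_succ, mul_assoc], ?_, ?_⟩
    · rw [hK.card_newSimplices hA h3, hK.card_filter_subdivide hA h3 (by norm_num)] at h3'
      rw [pow_succ]
      norm_num at h3'
      linarith
    · rw [hK.card_newSimplices hA h3, hK.card_filter_subdivide hA h3 (i := 1) (by norm_num)] at h4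
      rw [pow_succ]
      norm_num at h4
      linarith

end IsComplex

end General

/-! ### From plane complexes to planar graphs without long cycles -/

section Plane

variable {K : Finset (Finset (EuclideanSpace ℝ (Fin 2)))}

lemma openSegment_subset_openCell {E : Type*} [AddCommGroup E] [Module ℝ E] {a b : E} (h : a ≠ b) :
    openSegment ℝ a b ⊆ openCell {a, b} := by
  rintro x ⟨s, t, hs, ht, hst, rfl⟩
  refine ⟨fun p => if p = a then s else t, ?_, ?_, ?_⟩
  · intro p _
    dsimp only
    split_ifs <;> assumption
  · rw [Finset.sum_pair h]
    simp [h.symm, hst]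
  · rw [Finset.sum_pair h]
    simp [h.symm]

lemma mem_segment_iff {E : Type*} [AddCommGroup E] [Module ℝ E] {a b x : E}
    (h : x ∈ segment ℝ a b) : x = a ∨ x = b ∨ x ∈ openSegment ℝ a b := by
  rw [← insert_endpoints_openSegment] at h
  simpa using h

/-- The graph on a family of vertices of a complex that is induced by its one-skeleton. -/
def inducedGraph {V E : Type*} (K : Finset (Finset E)) (p : V → E) : SimpleGraph V where
  Adj u v := Adj K (p u) (p v)
  symm := ⟨fun _ _ h => h.symm⟩
  loopless := ⟨fun _ h => h.1 rfl⟩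

/-- Edges are drawn as segments. A segment is its two ends together with an open cell, and distinct
cells are disjoint, which rules out both crossings and vertices inside edges. -/
lemma IsComplex.isPlanar_inducedGraph {V : Type*} (hK : IsComplex K)
    {p : V → EuclideanSpace ℝ (Fin 2)} (hp : Function.Injective p) (hV : ∀ v, {p v} ∈ K) :
    (inducedGraph K p).IsPlanar := by
  have hA : ∀ u v, convexHull ℝ (p '' {w | w ∈ s(u, v)}) = segment ℝ (p u) (p v) := by
    intro u v
    rw [← convexHull_pair]
    congr 1
    ext x
    simp [eq_comm]
  refine ⟨p, fun e => convexHull ℝ (p '' {w | w ∈ e}), hp, ?_, ?_, ?_⟩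
  · intro u v h
    exact ⟨Path.segment (p u) (p v), Path.segment_injective_of_ne h.1,
      by rw [Path.range_segment]; exact (hA u v).symm⟩
  · intro e he w hw
    induction e with | _ u v
    replace hw : p w ∈ segment ℝ (p u) (p v) := hA u v ▸ hw
    rw [SimpleGraph.mem_edgeSet] at he
    rcases mem_segment_iff hw with h | h | h
    · simp [hp h]
    · simp [hp h]
    · have := hK.cell_inj _ he.2 _ (hV w) _ (openSegment_subset_openCell he.1 h)
        (self_mem_openCell _)
      have h5 : p u = p w := Finset.mem_singleton.1 (by rw [← this]; simp)
      simp [hp h5]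
  · intro e he f hf hne x hx
    induction e with | _ u v
    induction f with | _ u' v'
    rw [SimpleGraph.mem_edgeSet] at he hf
    replace hx : x ∈ segment ℝ (p u) (p v) ∩ segment ℝ (p u') (p v') := hA u v ▸ hA u' v' ▸ hx
    rcases mem_segment_iff hx.1 with h | h | h
    · exact ⟨u, h.symm⟩
    · exact ⟨v, h.symm⟩
    rcases mem_segment_iff hx.2 with h' | h' | h'
    · exact ⟨u', h'.symm⟩
    · exact ⟨v', h'.symm⟩
    have h3 := hK.cell_inj _ he.2 _ hf.2 _ (openSegment_subset_openCell he.1 h)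
      (openSegment_subset_openCell hf.1 h')
    refine absurd ?_ hne
    have h4 : ({p u, p v} : Set (EuclideanSpace ℝ (Fin 2))) = {p u', p v'} := by
      simpa using congrArg (fun s : Finset _ => (s : Set (EuclideanSpace ℝ (Fin 2)))) h3
    rw [Set.pair_eq_pair_iff] at h4
    rw [Sym2.eq_iff]
    rcases h4 with h4 | h4
    · exact .inl ⟨hp h4.1, hp h4.2⟩
    · exact .inr ⟨hp h4.1, hp h4.2⟩

lemma cycleGraph_free_inducedGraph {V E : Type*} {K : Finset (Finset E)} {p : V → E}
    (hp : Function.Injective p) {c k : ℕ} (hk : 2 ≤ k) (hck : c < k)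
    (hc : CycleBound K c) :
    (SimpleGraph.cycleGraph k).Free (inducedGraph K p) := by
  rintro ⟨f⟩
  obtain ⟨k, rfl⟩ := Nat.exists_eq_add_of_le' hk
  have hinj : Function.Injective (fun i => p (f i)) := hp.comp f.injective
  have hadj : ∀ i j, j - i = 1 → Adj K (p (f i)) (p (f j)) := fun i j h =>
    f.toHom.map_adj (SimpleGraph.cycleGraph_adj.2 (.inr h))
  have := hc (List.ofFn fun i => p (f i)) (List.nodup_ofFn.2 hinj) (by
    rw [List.ofFn_succ, Cycle.chain_coe_cons, ← List.cons_append,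
      ← List.ofFn_succ (f := fun i => p (f i)), List.isChain_append]
    refine ⟨?_, by simp, ?_⟩
    · rw [List.isChain_ofFn]
      intro i hi
      apply hadj
      rw [sub_eq_iff_eq_add, ← Fin.val_inj, Fin.val_add]
      simp only [Fin.val_one]
      rw [Nat.mod_eq_of_lt] <;> omega
    · intro a ha b hb
      have ha' : a = p (f (Fin.last _)) := by
        rw [List.getLast?_eq_getElem?, List.length_ofFn, List.getElem?_ofFn] at ha
        simpa [Fin.last, eq_comm] using ha
      have hb' : b = p (f 0) := by simpa [eq_comm] using hb
      subst ha' hb'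
      apply hadj
      rw [sub_eq_iff_eq_add, ← Fin.val_inj, Fin.val_add]
      simp [add_comm 1])
  rw [List.length_ofFn] at this
  omega

lemma IsComplex.card_edges_le_planarTuranNumber (hK : IsComplex K) {c k : ℕ} (hk : 2 ≤ k)
    (hck : c < k) (hc : CycleBound K c) :
    (K.filter (fun s => s.card = 2)).card ≤
      SimpleGraph.planarTuranNumber (K.filter (fun s => s.card = 1)).card
        (SimpleGraph.cycleGraph k) := by
  set n := (K.filter (fun s => s.card = 1)).card with hn
  set V := K.biUnion id with hVdef
  have hV : ∀ x, x ∈ V ↔ {x} ∈ K := by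
    intro x
    rw [hVdef, Finset.mem_biUnion]
    exact ⟨fun ⟨s, hs, hx⟩ => hK.singleton_mem hs hx, fun h => ⟨_, h, by simp⟩⟩
  have hcard : V.card = n := by
    rw [hn, ← Finset.card_image_of_injective V Finset.singleton_injective]
    congr 1
    ext s
    simp only [Finset.mem_image, hV, Finset.mem_filter, Finset.card_eq_one]
    constructor
    · rintro ⟨a, ha, rfl⟩
      exact ⟨ha, a, rfl⟩
    · rintro ⟨hs, a, rfl⟩
      exact ⟨a, hs, rfl⟩
  let e := V.equivFinOfCardEq hcard
  let p : Fin n → EuclideanSpace ℝ (Fin 2) := fun i => (e.symm i : EuclideanSpace ℝ (Fin 2))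
  have hp : Function.Injective p := Subtype.coe_injective.comp e.symm.injective
  have hpV : ∀ i, {p i} ∈ K := fun i => (hV _).1 (e.symm i).2
  have hsurj : ∀ x, {x} ∈ K → ∃ i, p i = x := fun x hx => ⟨e ⟨x, (hV x).2 hx⟩, by simp [p]⟩
  have hmem : inducedGraph K p ∈ ({G : SimpleGraph (Fin n) | G.IsPlanar ∧
      (SimpleGraph.cycleGraph k).Free G} : Finset (SimpleGraph (Fin n))) := by
    rw [Finset.mem_filter]
    exact ⟨Finset.mem_univ _, hK.isPlanar_inducedGraph hp hpV,
      cycleGraph_free_inducedGraph hp hk hck hc⟩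
  refine le_trans ?_ (Finset.le_sup (f := fun G : SimpleGraph (Fin n) => G.edgeFinset.card) hmem)
  refine Finset.card_le_card_of_surjOn (fun e => e.toFinset.image p) ?_
  intro s hs
  rw [Finset.mem_coe, Finset.mem_filter, Finset.card_eq_two] at hs
  obtain ⟨hs, a, b, hab, rfl⟩ := hs
  obtain ⟨i, rfl⟩ := hsurj a (hK.singleton_mem hs (by simp))
  obtain ⟨j, rfl⟩ := hsurj b (hK.singleton_mem hs (by simp))
  refine ⟨s(i, j), ?_, ?_⟩
  · rw [Finset.mem_coe, SimpleGraph.mem_edgeFinset, SimpleGraph.mem_edgeSet]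
    exact ⟨hab, by convert hs⟩
  · simp [Sym2.toFinset_mk_eq, Finset.image_insert]

end Plane

lemma length_le_card_of_nodup {E : Type*} {t : List E} {B : Finset E} (hn : t.Nodup) (h : ∀ x ∈ t, x ∈ B) :
    t.length ≤ B.card := by
  rw [← List.toFinset_card_of_nodup hn]
  exact Finset.card_le_card fun x hx => h x (List.mem_toFinset.1 hx)

/-! ### The friendship complex: triangles sharing the origin, separated by cones -/

section Friendship

variable {E : Type*} [AddCommGroup E] [Module ℝ E]

lemma bary_nonneg (f : E →ₗ[ℝ] ℝ) {s : Finset E} (h : ∀ p ∈ s, 0 ≤ f p) : 0 ≤ f (bary s) := by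
  rw [bary, map_smul, map_sum, smul_eq_mul]
  exact mul_nonneg (by positivity) (Finset.sum_nonneg h)

lemma BaryIndep.mono {s t : Finset E} (hs : BaryIndep s) (h : t ⊆ s) : BaryIndep t := by
  intro w h1 h2 p hp
  have := hs (fun p => if p ∈ t then w p else 0) (by
      rw [← Finset.sum_filter, Finset.filter_mem_eq_inter, Finset.inter_eq_right.2 h, h1]) (by
      simp only [ite_smul, zero_smul]
      rw [← Finset.sum_filter, Finset.filter_mem_eq_inter, Finset.inter_eq_right.2 h, h2]) p (h hp)
  simpa [hp] using this

variable (φ : E ≃ₗ[ℝ] ℝ × ℝ)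

/-- The point with coordinates `(1, j)`. -/
def linePt (j : ℕ) : E := φ.symm (1, j)

@[simp] lemma linePt_fst (j : ℕ) : (φ (linePt φ j)).1 = 1 := by simp [linePt]

@[simp] lemma linePt_snd (j : ℕ) : (φ (linePt φ j)).2 = j := by simp [linePt]

lemma linePt_injective : Function.Injective (linePt φ) := by
  intro i j h
  have := congrArg (fun z => (φ z).2) h
  simpa using this

lemma linePt_ne_zero (j : ℕ) : linePt φ j ≠ 0 := by
  intro h
  have := congrArg (fun z => (φ z).1) h
  simp at this

/-- The triangle with vertices `(0, 0)`, `(1, a)` and `(1, a + 1)`. -/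
noncomputable def fanTriangle (a : ℕ) : Finset E := {0, linePt φ a, linePt φ (a + 1)}

lemma sum_fanTriangle {M : Type*} [AddCommMonoid M] (a : ℕ) (f : E → M) :
    ∑ p ∈ fanTriangle φ a, f p = f 0 + (f (linePt φ a) + f (linePt φ (a + 1))) := by
  have h : linePt φ a ≠ linePt φ (a + 1) := fun h => by simpa using linePt_injective φ h
  rw [fanTriangle, Finset.sum_insert, Finset.sum_pair h]
  simp [(linePt_ne_zero φ _).symm]

lemma card_fanTriangle (a : ℕ) : (fanTriangle φ a).card = 3 := by
  rw [Finset.card_eq_sum_ones, sum_fanTriangle]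
  norm_num

lemma baryIndep_fanTriangle (a : ℕ) : BaryIndep (fanTriangle φ a) := by
  intro w h1 h2 p hp
  rw [sum_fanTriangle] at h1 h2
  have h3 := congrArg (fun z => (φ z).1) h2
  have h4 := congrArg (fun z => (φ z).2) h2
  simp at h3 h4
  have hb : w (linePt φ (a + 1)) = 0 := by linear_combination h4 - a * h3
  have ha : w (linePt φ a) = 0 := by linear_combination h3 - hb
  have h0 : w 0 = 0 := by linear_combination h1 - ha - hb
  simp only [fanTriangle, Finset.mem_insert, Finset.mem_singleton] at hp
  rcases hp with rfl | rfl | rfl <;> assumption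

lemma weights_of_mem_openCell {a : ℕ} {s : Finset E} (hs : s ⊆ fanTriangle φ a) {x : E}
    (hx : x ∈ openCell s) :
    ∃ u v w : ℝ, u + v + w = 1 ∧ (φ x).1 = v + w ∧ (φ x).2 = a * v + (a + 1) * w ∧
      0 ≤ u ∧ 0 ≤ v ∧ 0 ≤ w ∧
      (0 ∈ s ↔ 0 < u) ∧ (linePt φ a ∈ s ↔ 0 < v) ∧ (linePt φ (a + 1) ∈ s ↔ 0 < w) := by
  obtain ⟨c, hc, h1, h2⟩ := hx
  set c' : E → ℝ := fun p => if p ∈ s then c p else 0 with hc'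
  have h1' : ∑ p ∈ fanTriangle φ a, c' p = 1 := by
    rw [hc', ← Finset.sum_filter, Finset.filter_mem_eq_inter, Finset.inter_eq_right.2 hs, h1]
  have h2' : ∑ p ∈ fanTriangle φ a, c' p • p = x := by
    simp only [hc', ite_smul, zero_smul]
    rw [← Finset.sum_filter, Finset.filter_mem_eq_inter, Finset.inter_eq_right.2 hs, h2]
  rw [sum_fanTriangle] at h1' h2'
  have hpos : ∀ p, 0 ≤ c' p := by
    intro p
    simp only [hc']
    split_ifs with h
    · exact (hc p h).le
    · rfl
  have hiff : ∀ p, p ∈ s ↔ 0 < c' p := by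
    intro p
    simp only [hc']
    split_ifs with h
    · simp [h, hc p h]
    · simp [h]
  refine ⟨c' 0, c' (linePt φ a), c' (linePt φ (a + 1)), by linarith, ?_, ?_, hpos _, hpos _,
    hpos _, hiff _, hiff _, hiff _⟩
  · rw [← h2']
    simp
  · rw [← h2']
    simp [mul_comm]

/-- A point determines the cell of a fan triangle that contains it. -/
lemma mem_iff_of_mem_openCell {a : ℕ} {s : Finset E} (hs : s ⊆ fanTriangle φ a) {x : E}
    (hx : x ∈ openCell s) (z : E) :
    z ∈ s ↔ (z = 0 ∧ (φ x).1 < 1) ∨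
      ∃ j : ℕ, z = linePt φ j ∧ |(φ x).2 - j * (φ x).1| < (φ x).1 := by
  obtain ⟨u, v, w, h1, hX, hY, hu, hv, hw, iu, iv, iw⟩ := weights_of_mem_openCell φ hs hx
  -- Write `X`, `Y` for the coordinates of `x`. Here `X = v + w` and `Y - a * X = w`, so the strict
  -- inequality says exactly `0 < v`; the vertex `a + 1` is symmetric.
  have ha : |(φ x).2 - a * (φ x).1| < (φ x).1 ↔ 0 < v := by
    rw [hX, hY, show (a * v + (a + 1) * w - a * (v + w) : ℝ) = w by ring, abs_of_nonneg hw]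
    constructor <;> intro <;> linarith
  have hb : |(φ x).2 - (a + 1 : ℕ) * (φ x).1| < (φ x).1 ↔ 0 < w := by
    rw [hX, hY]
    push_cast
    rw [show (a * v + (a + 1) * w - (a + 1) * (v + w) : ℝ) = -v by ring, abs_neg, abs_of_nonneg hv]
    constructor <;> intro <;> linarith
  constructor
  · intro hz
    have := hs hz
    simp only [fanTriangle, Finset.mem_insert, Finset.mem_singleton] at this
    rcases this with rfl | rfl | rfl
    · exact .inl ⟨rfl, by rw [hX]; linarith [iu.1 hz]⟩
    · exact .inr ⟨a, rfl, ha.2 (iv.1 hz)⟩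
    · exact .inr ⟨a + 1, rfl, hb.2 (iw.1 hz)⟩
  · rintro (⟨rfl, h⟩ | ⟨j, rfl, h⟩)
    · exact iu.2 (by linarith)
    -- The slope `Y / X` lies in `[a, a + 1]`, so any other index `j` is at distance at least one
    -- from it and fails the strict inequality.
    · rcases lt_trichotomy j a with hj | rfl | hj
      · have hj' : (j : ℝ) + 1 ≤ a := by exact_mod_cast hj
        rw [hX, hY] at h
        have := (abs_lt.1 h).2
        nlinarith [mul_nonneg hv (sub_nonneg.2 hj'), mul_nonneg hw (sub_nonneg.2 hj')]
      · exact iv.2 (ha.1 h)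
      · rcases (Nat.succ_le_of_lt hj).eq_or_lt with rfl | hj
        · exact iw.2 (hb.1 h)
        · have hj' : (a : ℝ) + 1 + 1 ≤ j := by exact_mod_cast hj
          rw [hX, hY] at h
          have := (abs_lt.1 h).1
          nlinarith [mul_nonneg hv (sub_nonneg.2 hj'), mul_nonneg hw (sub_nonneg.2 hj')]

/-- The friendship complex: `m` triangles sharing the origin, and `r` isolated points. -/
noncomputable def friendship (m r : ℕ) : Finset (Finset E) :=
  ((Finset.range m).biUnion (fun i => (fanTriangle φ (2 * i)).powerset) ∪
    (Finset.range (2 * m + r)).image fun j => {linePt φ j}).erase ∅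

lemma mem_friendship {m r : ℕ} {s : Finset E} :
    s ∈ friendship φ m r ↔ s ≠ ∅ ∧ ((∃ i < m, s ⊆ fanTriangle φ (2 * i)) ∨
      ∃ j < 2 * m + r, {linePt φ j} = s) := by
  simp [friendship]

lemma exists_subset_fanTriangle {m r : ℕ} {s : Finset E} (hs : s ∈ friendship φ m r) :
    ∃ a, s ⊆ fanTriangle φ a := by
  obtain ⟨-, ⟨i, -, h⟩ | ⟨j, -, rfl⟩⟩ := (mem_friendship φ).1 hs
  · exact ⟨_, h⟩
  · exact ⟨j, by simp [fanTriangle]⟩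

/-- The criterion of `mem_iff_of_mem_openCell` does not mention the index of the triangle, so cells
in different triangles are compared directly. -/
lemma isComplex_friendship (m r : ℕ) : IsComplex (friendship φ m r) where
  nonempty s hs := Finset.nonempty_iff_ne_empty.2 ((mem_friendship φ).1 hs).1
  card_le s hs := by
    obtain ⟨a, ha⟩ := exists_subset_fanTriangle φ hs
    exact (Finset.card_le_card ha).trans (card_fanTriangle φ a).le
  down s hs t ht hne := by
    refine (mem_friendship φ).2 ⟨hne.ne_empty, ?_⟩
    obtain ⟨-, ⟨i, hi, h⟩ | ⟨j, hj, rfl⟩⟩ := (mem_friendship φ).1 hs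
    · exact .inl ⟨i, hi, ht.trans h⟩
    · exact .inr ⟨j, hj, ((Finset.subset_singleton_iff.1 ht).resolve_left hne.ne_empty).symm⟩
  indep s hs := by
    obtain ⟨a, ha⟩ := exists_subset_fanTriangle φ hs
    exact (baryIndep_fanTriangle φ a).mono ha
  cell_inj s hs t ht x hx hx' := by
    obtain ⟨a, ha⟩ := exists_subset_fanTriangle φ hs
    obtain ⟨b, hb⟩ := exists_subset_fanTriangle φ ht
    ext z
    rw [mem_iff_of_mem_openCell φ ha hx, mem_iff_of_mem_openCell φ hb hx']

/-- The cone spanned by the points `(1, 2 * i)` and `(1, 2 * i + 1)`. -/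
def cone (i : ℕ) : Set E :=
  {z | 0 ≤ (φ z).1 ∧ 0 ≤ (φ z).2 - 2 * i * (φ z).1 ∧ 0 ≤ (2 * i + 1) * (φ z).1 - (φ z).2}

lemma bary_mem_cone {i : ℕ} {s : Finset E} (h : ∀ p ∈ s, p ∈ cone φ i) : bary s ∈ cone φ i := by
  let X : E →ₗ[ℝ] ℝ := LinearMap.fst ℝ ℝ ℝ ∘ₗ φ.toLinearMap
  let Y : E →ₗ[ℝ] ℝ := LinearMap.snd ℝ ℝ ℝ ∘ₗ φ.toLinearMap
  exact ⟨bary_nonneg X fun p hp => (h p hp).1,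
    bary_nonneg (Y - (2 * i : ℝ) • X) fun p hp => (h p hp).2.1,
    bary_nonneg ((2 * i + 1 : ℝ) • X - Y) fun p hp => (h p hp).2.2⟩

/-- The `i`-th cone consists of slopes in `[2 * i, 2 * i + 1]`, and these intervals are disjoint. -/
lemma eq_of_mem_cone {i j : ℕ} {z : E} (hz : z ≠ 0) (hi : z ∈ cone φ i) (hj : z ∈ cone φ j) :
    i = j := by
  obtain ⟨h1, h2, h3⟩ := hi
  obtain ⟨-, h2', h3'⟩ := hj
  have hX : 0 < (φ z).1 := by
    refine lt_of_le_of_ne h1 fun h => hz ?_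
    rw [← h] at h2 h3
    apply φ.injective
    rw [map_zero]
    ext
    · exact h.symm
    · simp at h2 h3 ⊢
      linarith
  by_contra hne
  rcases lt_or_gt_of_ne hne with h | h
  · have : (i : ℝ) + 1 ≤ j := by exact_mod_cast h
    nlinarith [mul_nonneg h1 (sub_nonneg.2 this)]
  · have : (j : ℝ) + 1 ≤ i := by exact_mod_cast h
    nlinarith [mul_nonneg h1 (sub_nonneg.2 this)]

lemma linePt_mem_cone {i j : ℕ} : linePt φ j ∈ cone φ i ↔ j = 2 * i ∨ j = 2 * i + 1 := by
  have h : linePt φ j ∈ cone φ i ↔ (2 * i : ℝ) ≤ j ∧ (j : ℝ) ≤ 2 * i + 1 := by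
    simp [cone]
  rw [h]
  norm_cast
  omega

lemma zero_mem_cone (i : ℕ) : (0 : E) ∈ cone φ i := by simp [cone]

/-- Every simplex of the complex lies in one of the cones. -/
def InCones (K : Finset (Finset E)) : Prop := ∀ s ∈ K, ∃ i, ∀ p ∈ s, p ∈ cone φ i

lemma fanTriangle_subset_cone {i : ℕ} : ∀ p ∈ fanTriangle φ (2 * i), p ∈ cone φ i := by
  intro p hp
  simp only [fanTriangle, Finset.mem_insert, Finset.mem_singleton] at hp
  rcases hp with rfl | rfl | rfl
  · exact zero_mem_cone φ i
  · exact (linePt_mem_cone φ).2 (.inl rfl)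
  · exact (linePt_mem_cone φ).2 (.inr rfl)

lemma inCones_friendship (m r : ℕ) : InCones φ (friendship φ m r) := by
  intro s hs
  obtain ⟨-, ⟨i, hi, h⟩ | ⟨j, hj, rfl⟩⟩ := (mem_friendship φ).1 hs
  · exact ⟨i, fun p hp => fanTriangle_subset_cone φ p (h hp)⟩
  · refine ⟨j / 2, fun p hp => ?_⟩
    rw [Finset.mem_singleton.1 hp, linePt_mem_cone]
    omega

lemma InCones.subdivide {K A : Finset (Finset E)} (h : InCones φ K) (hA : A ⊆ K) :
    InCones φ (subdivide K A) := by
  intro t ht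
  rcases mem_subdivide.1 ht with ⟨ht, -⟩ | ⟨s, hs, T, hT, rfl⟩
  · exact h t ht
  · obtain ⟨i, hi⟩ := h s (hA hs)
    refine ⟨i, fun p hp => ?_⟩
    rcases Finset.mem_insert.1 hp with rfl | hp
    · exact bary_mem_cone φ hi
    · exact hi p (hT.1 hp)

/-- The vertices other than the origin that lie in the `i`-th cone. -/
noncomputable def block (K : Finset (Finset E)) (i : ℕ) : Finset E :=
  (K.biUnion id).filter fun p => p ≠ 0 ∧ p ∈ cone φ i

lemma mem_block {K : Finset (Finset E)} {i : ℕ} {p : E} :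
    p ∈ block φ K i ↔ (∃ s ∈ K, p ∈ s) ∧ p ≠ 0 ∧ p ∈ cone φ i := by
  simp [block]

/-- Every edge lies in one cone and a nonzero point in at most one, so a path can change cones only
at the origin. -/
lemma InCones.mem_block_of_chain {K : Finset (Finset E)} (h : InCones φ K) {i : ℕ} :
    ∀ (t : List E) (a : E), (a :: t).IsChain (Adj K) → (0 : E) ∉ a :: t → a ∈ block φ K i →
      ∀ x ∈ a :: t, x ∈ block φ K i := by
  intro t
  induction t with
  | nil =>
    intro a _ _ ha x hx
    rwa [List.mem_singleton.1 hx]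
  | cons b t ih =>
    intro a hc h0 ha x hx
    rw [List.isChain_cons_cons] at hc
    rw [List.mem_cons, not_or] at h0
    rcases List.mem_cons.1 hx with rfl | hx
    · exact ha
    · refine ih b hc.2 h0.2 ?_ x hx
      obtain ⟨j, hj⟩ := h _ hc.1.2
      rw [mem_block] at ha ⊢
      cases eq_of_mem_cone φ ha.2.1 ha.2.2 (hj a (by simp))
      exact ⟨⟨_, hc.1.2, by simp⟩, fun hb => h0.2 (by simp [hb]), hj b (by simp)⟩

/-- The origin separates the blocks, so a cycle consists of vertices of one block and possibly the
origin, which accounts for the `+ 1`. -/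
lemma InCones.cycleBound {K : Finset (Finset E)} (h : InCones φ K) {b : ℕ}
    (hb : ∀ i, (block φ K i).card ≤ b) : CycleBound K (b + 1) := by
  intro l hnd hl
  have hblock : ∀ {a x}, Adj K a x → x ≠ 0 → ∃ i, x ∈ block φ K i := by
    intro a x hax hx
    obtain ⟨i, hi⟩ := h _ hax.2
    exact ⟨i, (mem_block φ).2 ⟨⟨_, hax.2, by simp⟩, hx, hi x (by simp)⟩⟩
  by_cases h0 : (0 : E) ∈ l
  · obtain ⟨n, t, hr⟩ : ∃ n t, l.rotate n = 0 :: t := by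
      obtain ⟨s, t, rfl⟩ := List.append_of_mem h0
      exact ⟨s.length, t ++ s, by simp⟩
    have hp : (0 :: t).Perm l := hr ▸ List.rotate_perm l n
    have hcy : (l : Cycle E) = (0 :: t : List E) := Cycle.coe_eq_coe.2 ⟨n, hr⟩
    rw [hcy, Cycle.chain_coe_cons] at hl
    rw [← hp.length_eq, List.length_cons]
    have hnd' := List.nodup_cons.1 (hp.nodup_iff.2 hnd)
    refine Nat.succ_le_succ ?_
    cases t with
    | nil => simp
    | cons x t =>
      simp only [List.cons_append, List.isChain_cons_cons] at hl
      obtain ⟨i, hi⟩ := hblock hl.1 hl.1.1.symm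
      rw [← List.cons_append] at hl
      exact (length_le_card_of_nodup hnd'.2 (h.mem_block_of_chain φ t x
        (List.isChain_append.1 hl.2).1 hnd'.1 hi)).trans (hb i)
  · cases l with
    | nil => simp
    | cons a t =>
      rw [Cycle.chain_coe_cons] at hl
      cases t with
      | nil => simp
      | cons x t =>
        have hl' := hl
        simp only [List.cons_append, List.isChain_cons_cons] at hl
        obtain ⟨i, hi⟩ := hblock hl.1.symm (fun h => h0 (by simp [h]))
        rw [← List.cons_append] at hl'
        exact ((length_le_card_of_nodup hnd (h.mem_block_of_chain φ _ a
          (List.isChain_append.1 hl').1 h0 hi)).trans (hb i)).trans (Nat.le_succ _)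

/-- At most one starred simplex, `S`, lies in the cone, so its barycenter is the only possible new
vertex there. -/
lemma card_block_subdivide_le {K A : Finset (Finset E)} (h : InCones φ K) (hA : A ⊆ K) {i : ℕ} {S : Finset E}
    (hS : ∀ s ∈ A, (∀ p ∈ s, p ∈ cone φ i) → s = S) :
    (block φ (subdivide K A) i).card ≤ (block φ K i).card + 1 := by
  refine (Finset.card_le_card ?_).trans (Finset.card_insert_le (bary S) _)
  intro p hp
  obtain ⟨⟨t, ht, hpt⟩, hp0, hpi⟩ := (mem_block φ).1 hp
  rw [Finset.mem_insert, mem_block]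
  rcases mem_subdivide.1 ht with ⟨ht, -⟩ | ⟨s, hs, T, hT, rfl⟩
  · exact .inr ⟨⟨t, ht, hpt⟩, hp0, hpi⟩
  · rcases Finset.mem_insert.1 hpt with rfl | hpT
    · obtain ⟨j, hj⟩ := h s (hA hs)
      cases eq_of_mem_cone φ hp0 hpi (bary_mem_cone φ hj)
      exact .inl (by rw [hS s hs hj])
    · exact .inr ⟨⟨s, hA hs, hT.1 hpT⟩, hp0, hpi⟩

lemma card_block_friendship_le (m r i : ℕ) : (block φ (friendship φ m r) i).card ≤ 2 := by
  refine (Finset.card_le_card (t := {linePt φ (2 * i), linePt φ (2 * i + 1)}) ?_).trans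
    Finset.card_le_two
  intro p hp
  obtain ⟨⟨s, hs, hps⟩, hp0, hpi⟩ := (mem_block φ).1 hp
  obtain ⟨a, ha⟩ := exists_subset_fanTriangle φ hs
  have := ha hps
  simp only [fanTriangle, Finset.mem_insert, Finset.mem_singleton, hp0, false_or] at this
  obtain ⟨j, rfl⟩ : ∃ j, p = linePt φ j := this.elim (fun h => ⟨_, h⟩) (fun h => ⟨_, h⟩)
  rcases (linePt_mem_cone φ).1 hpi with rfl | rfl <;> simp

lemma linePt_mem_fanTriangle {a : ℕ} : linePt φ a ∈ fanTriangle φ a := by simp [fanTriangle]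

lemma eq_of_linePt_mem_cone {i j : ℕ} (h : linePt φ (2 * i) ∈ cone φ j) : i = j := by
  rw [linePt_mem_cone] at h
  omega

/-- The triangles of the friendship complex. -/
noncomputable def friendshipFaces (m : ℕ) : Finset (Finset E) :=
  (Finset.range m).image fun i => fanTriangle φ (2 * i)

lemma card_friendshipFaces (m : ℕ) : (friendshipFaces φ m).card = m := by
  rw [friendshipFaces, Finset.card_image_of_injective, Finset.card_range]
  intro i j h
  have h' : fanTriangle φ (2 * i) = fanTriangle φ (2 * j) := h
  exact eq_of_linePt_mem_cone φ (fanTriangle_subset_cone φ _ (h' ▸ linePt_mem_fanTriangle φ))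

lemma friendshipFaces_subset (m r : ℕ) : friendshipFaces φ m ⊆ friendship φ m r := by
  intro s hs
  simp only [friendshipFaces, Finset.mem_image, Finset.mem_range] at hs
  obtain ⟨i, hi, rfl⟩ := hs
  refine (mem_friendship φ).2 ⟨?_, .inl ⟨i, hi, subset_rfl⟩⟩
  exact Finset.ne_empty_of_mem (linePt_mem_fanTriangle φ)

lemma card_of_mem_friendshipFaces {m : ℕ} : ∀ s ∈ friendshipFaces φ m, s.card = 3 := by
  intro s hs
  simp only [friendshipFaces, Finset.mem_image, Finset.mem_range] at hs
  obtain ⟨i, hi, rfl⟩ := hs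
  exact card_fanTriangle φ _

lemma card_vertices_friendship {m : ℕ} (hm : 0 < m) (r : ℕ) :
    ((friendship φ m r).filter (fun s => s.card = 1)).card = 1 + 2 * m + r := by
  have : (friendship φ m r).filter (fun s => s.card = 1)
      = (insert 0 ((Finset.range (2 * m + r)).image (linePt φ))).image singleton := by
    ext s
    simp only [Finset.mem_filter, mem_friendship, Finset.card_eq_one, Finset.mem_image,
      Finset.mem_insert, Finset.mem_range]
    constructor
    · rintro ⟨⟨-, ⟨i, hi, h⟩ | ⟨j, hj, rfl⟩⟩, a, ha⟩
      · subst ha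
        refine ⟨a, ?_, rfl⟩
        simp only [Finset.singleton_subset_iff, fanTriangle, Finset.mem_insert,
          Finset.mem_singleton] at h
        rcases h with h | h | h
        · exact .inl h
        · exact .inr ⟨_, by omega, h.symm⟩
        · exact .inr ⟨_, by omega, h.symm⟩
      · exact ⟨_, .inr ⟨j, hj, rfl⟩, rfl⟩
    · rintro ⟨a, rfl | ⟨j, hj, rfl⟩, rfl⟩
      -- The origin is a vertex only because there is at least one triangle.
      · exact ⟨⟨by simp, .inl ⟨0, hm, by simp [fanTriangle]⟩⟩, 0, rfl⟩
      · exact ⟨⟨by simp, .inr ⟨j, hj, rfl⟩⟩, _, rfl⟩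
  rw [this, Finset.card_image_of_injective _ Finset.singleton_injective,
    Finset.card_insert_of_notMem, Finset.card_image_of_injective _ (linePt_injective φ),
    Finset.card_range]
  · omega
  · simp [linePt_ne_zero]

lemma card_edges_friendship (m r : ℕ) :
    ((friendship φ m r).filter (fun s => s.card = 2)).card = 3 * m := by
  have : (friendship φ m r).filter (fun s => s.card = 2)
      = (Finset.range m).biUnion fun i => (fanTriangle φ (2 * i)).powersetCard 2 := by
    ext s
    simp only [Finset.mem_filter, mem_friendship, Finset.mem_biUnion, Finset.mem_range,
      Finset.mem_powersetCard]
    constructor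
    · rintro ⟨⟨-, ⟨i, hi, h⟩ | ⟨j, hj, rfl⟩⟩, hc⟩
      · exact ⟨i, hi, h, hc⟩
      · simp at hc
    · rintro ⟨i, hi, h, hc⟩
      refine ⟨⟨?_, .inl ⟨i, hi, h⟩⟩, hc⟩
      rintro rfl
      simp at hc
  rw [this, Finset.card_biUnion, Finset.sum_const_nat (m := 3), Finset.card_range, mul_comm]
  · intro i _
    rw [Finset.card_powersetCard, card_fanTriangle]
    rfl
  · intro i _ j _ hij
    rw [Function.onFun, Finset.disjoint_left]
    intro s hs hs'
    rw [Finset.mem_powersetCard] at hs hs'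
    -- An edge has an end other than the origin, and that end determines its cone.
    obtain ⟨p, hp, hp0⟩ := Finset.exists_mem_ne (by omega : 1 < s.card) 0
    exact hij (eq_of_mem_cone φ hp0 (fanTriangle_subset_cone φ p (hs.1 hp))
      (fanTriangle_subset_cone φ p (hs'.1 hp)))

end Friendship

/-! ### The two starting blocks, with four and five vertices -/

section Blocks

variable {E : Type*} [AddCommGroup E] [Module ℝ E] (φ : E ≃ₗ[ℝ] ℝ × ℝ)

/-- The friendship complex with all triangles starred: blocks are copies of `K₄`. -/
noncomputable def wheelComplex (m r : ℕ) : Finset (Finset E) :=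
  subdivide (friendship φ m r) (friendshipFaces φ m)

/-- The inner triangles of the blocks of `wheelComplex`. -/
noncomputable def wheelFaces (m : ℕ) : Finset (Finset E) := newSimplices (friendshipFaces φ m) 2

/-- The triangle of the `i`-th block of `wheelComplex` that avoids the origin. -/
noncomputable def outerFace (i : ℕ) : Finset E :=
  insert (bary (fanTriangle φ (2 * i))) ((fanTriangle φ (2 * i)).erase 0)

/-- The triangles of `wheelComplex` that avoid the origin. -/
noncomputable def outerFaces (m : ℕ) : Finset (Finset E) := (Finset.range m).image (outerFace φ)

lemma isComplex_wheelComplex (m r : ℕ) : IsComplex (wheelComplex φ m r) :=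
  (isComplex_friendship φ m r).subdivide (friendshipFaces_subset φ m r)
    (card_of_mem_friendshipFaces φ)

lemma wheelFaces_subset (m r : ℕ) : wheelFaces φ m ⊆ wheelComplex φ m r :=
  IsComplex.newSimplices_subset (card_of_mem_friendshipFaces φ) le_rfl

lemma card_of_mem_wheelFaces {m : ℕ} : ∀ s ∈ wheelFaces φ m, s.card = 3 := fun _ hs =>
  (isComplex_friendship φ m 0).card_of_mem_newSimplices (friendshipFaces_subset φ m 0)
    (card_of_mem_friendshipFaces φ) hs

lemma card_wheelFaces (m : ℕ) : (wheelFaces φ m).card = 3 * m := by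
  rw [wheelFaces, (isComplex_friendship φ m 0).card_newSimplices (friendshipFaces_subset φ m 0)
    (card_of_mem_friendshipFaces φ), card_friendshipFaces, mul_comm]
  rfl

lemma inCones_wheelComplex (m r : ℕ) : InCones φ (wheelComplex φ m r) :=
  (inCones_friendship φ m r).subdivide φ (friendshipFaces_subset φ m r)

lemma card_block_wheelComplex_le (m r i : ℕ) : (block φ (wheelComplex φ m r) i).card ≤ 3 := by
  refine (card_block_subdivide_le φ (inCones_friendship φ m r) (friendshipFaces_subset φ m r)
    (S := fanTriangle φ (2 * i)) ?_).trans (Nat.succ_le_succ (card_block_friendship_le φ m r i))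
  intro s hs hc
  simp only [friendshipFaces, Finset.mem_image, Finset.mem_range] at hs
  obtain ⟨j, hj, rfl⟩ := hs
  rw [eq_of_linePt_mem_cone φ (hc _ (linePt_mem_fanTriangle φ))]

lemma card_vertices_wheelComplex {m : ℕ} (hm : 0 < m) (r : ℕ) :
    ((wheelComplex φ m r).filter (fun s => s.card = 1)).card = 1 + 3 * m + r := by
  have := (isComplex_friendship φ m r).card_filter_subdivide (friendshipFaces_subset φ m r)
    (card_of_mem_friendshipFaces φ) (i := 0) (by norm_num)
  simp only [zero_add, card_vertices_friendship φ hm, card_friendshipFaces, Nat.choose_zero_right]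
    at this
  rw [wheelComplex, this]
  ring

lemma card_edges_wheelComplex (m r : ℕ) :
    ((wheelComplex φ m r).filter (fun s => s.card = 2)).card = 6 * m := by
  have := (isComplex_friendship φ m r).card_filter_subdivide (friendshipFaces_subset φ m r)
    (card_of_mem_friendshipFaces φ) (i := 1) (by norm_num)
  simp only [Nat.reduceAdd, card_edges_friendship φ, card_friendshipFaces, Nat.choose_one_right]
    at this
  rw [wheelComplex, this]
  ring

lemma linePt_mem_outerFace (i : ℕ) : linePt φ (2 * i) ∈ outerFace φ i :=
  Finset.mem_insert_of_mem
    (Finset.mem_erase.2 ⟨linePt_ne_zero φ _, linePt_mem_fanTriangle φ⟩)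

lemma outerFace_subset_cone {i : ℕ} : ∀ p ∈ outerFace φ i, p ∈ cone φ i := by
  intro p hp
  rcases Finset.mem_insert.1 hp with rfl | hp
  · exact bary_mem_cone φ (fanTriangle_subset_cone φ)
  · exact fanTriangle_subset_cone φ p (Finset.mem_of_mem_erase hp)

lemma card_outerFaces (m : ℕ) : (outerFaces φ m).card = m := by
  rw [outerFaces, Finset.card_image_of_injective, Finset.card_range]
  intro i j h
  exact eq_of_linePt_mem_cone φ (outerFace_subset_cone φ _ (h ▸ linePt_mem_outerFace φ i))

lemma outerFaces_subset (m : ℕ) : outerFaces φ m ⊆ wheelFaces φ m := by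
  intro s hs
  simp only [outerFaces, Finset.mem_image, Finset.mem_range] at hs
  obtain ⟨i, hi, rfl⟩ := hs
  refine mem_newSimplices.2 ⟨fanTriangle φ (2 * i), ?_, _, ⟨Finset.erase_subset 0 _, ?_⟩, rfl⟩
  · exact Finset.mem_image_of_mem _ (Finset.mem_range.2 hi)
  · rw [Finset.card_erase_of_mem (by simp [fanTriangle]), card_fanTriangle]

/-- A complex all of whose cycles have at most `s + 3` vertices, whose blocks have `s + 3` vertices
and whose inner faces are to be subdivided. -/
def HasBlocks (E : Type*) [AddCommGroup E] [Module ℝ E] (s : ℕ) : Prop :=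
  ∀ m r : ℕ, 0 < m → ∃ K A : Finset (Finset E), IsComplex K ∧ A ⊆ K ∧ (∀ t ∈ A, t.card = 3) ∧
    CycleBound K (s + 3) ∧ (K.filter (fun s => s.card = 1)).card = 1 + (s + 2) * m + r ∧
    (K.filter (fun s => s.card = 2)).card = 3 * (s + 1) * m ∧ A.card = (2 * s + 1) * m

lemma hasBlocks_one {E : Type*} [AddCommGroup E] [Module ℝ E] (φ : E ≃ₗ[ℝ] ℝ × ℝ) : HasBlocks E 1 :=
  fun m r hm =>
  ⟨wheelComplex φ m r, wheelFaces φ m, isComplex_wheelComplex φ m r, wheelFaces_subset φ m r,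
    card_of_mem_wheelFaces φ,
    (inCones_wheelComplex φ m r).cycleBound φ (card_block_wheelComplex_le φ m r),
    card_vertices_wheelComplex φ hm r, card_edges_wheelComplex φ m r, card_wheelFaces φ m⟩

/-- Starring one of the three inner faces of each K₄ gives five vertices and `2 + 3 = 5` inner
faces. Choosing the face that avoids the origin makes the blocks easy to tell apart. -/
lemma hasBlocks_two {E : Type*} [AddCommGroup E] [Module ℝ E] (φ : E ≃ₗ[ℝ] ℝ × ℝ) :
    HasBlocks E 2 := by
  intro m r hm
  have hK := isComplex_wheelComplex φ m r
  have hO : outerFaces φ m ⊆ wheelComplex φ m r :=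
    (outerFaces_subset φ m).trans (wheelFaces_subset φ m r)
  have h3 : ∀ s ∈ outerFaces φ m, s.card = 3 := fun s hs =>
    card_of_mem_wheelFaces φ s (outerFaces_subset φ m hs)
  refine ⟨subdivide (wheelComplex φ m r) (outerFaces φ m),
    (wheelFaces φ m \ outerFaces φ m) ∪ newSimplices (outerFaces φ m) 2, hK.subdivide hO h3,
    ?_, ?_, ?_, ?_, ?_, ?_⟩
  · refine Finset.union_subset (fun s hs => ?_) (IsComplex.newSimplices_subset h3 le_rfl)
    rw [Finset.mem_sdiff] at hs
    exact mem_subdivide.2 (.inl ⟨wheelFaces_subset φ m r hs.1, hs.2⟩)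
  · intro s hs
    rcases Finset.mem_union.1 hs with hs | hs
    · exact card_of_mem_wheelFaces φ s (Finset.mem_sdiff.1 hs).1
    · exact hK.card_of_mem_newSimplices hO h3 hs
  · refine ((inCones_wheelComplex φ m r).subdivide φ hO).cycleBound φ fun i => ?_
    refine (card_block_subdivide_le φ (inCones_wheelComplex φ m r) hO
      (S := outerFace φ i) ?_).trans (Nat.succ_le_succ (card_block_wheelComplex_le φ m r i))
    intro s hs hc
    simp only [outerFaces, Finset.mem_image, Finset.mem_range] at hs
    obtain ⟨j, hj, rfl⟩ := hs
    rw [eq_of_linePt_mem_cone φ (hc _ (linePt_mem_outerFace φ j))]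
  · have := hK.card_filter_subdivide hO h3 (i := 0) (by norm_num)
    simp only [zero_add, card_vertices_wheelComplex φ hm, card_outerFaces,
      Nat.choose_zero_right] at this
    rw [this]
    ring
  · have := hK.card_filter_subdivide hO h3 (i := 1) (by norm_num)
    simp only [Nat.reduceAdd, card_edges_wheelComplex φ, card_outerFaces,
      Nat.choose_one_right] at this
    rw [this]
    ring
  · rw [Finset.card_union_of_disjoint, Finset.card_sdiff_of_subset (outerFaces_subset φ m),
      hK.card_newSimplices hO h3, card_wheelFaces, card_outerFaces]
    · norm_num [Nat.choose]
      omega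
    · rw [Finset.disjoint_left]
      intro t ht ht'
      obtain ⟨s, hs, T, -, rfl⟩ := mem_newSimplices.1 ht'
      exact hK.bary_notMem (hO hs) (h3 s hs)
        (wheelFaces_subset φ m r (Finset.mem_sdiff.1 ht).1) (Finset.mem_insert_self _ _)

end Blocks

/-! ### Edge counts and the asymptotic bound -/

lemma HasBlocks.le_planarTuranNumber {s : ℕ} (h : HasBlocks (EuclideanSpace ℝ (Fin 2)) s)
    {j t k : ℕ} (ht : 2 * t = (2 * s + 1) * 3 ^ j + 3) (hk : 2 ^ j * (s + 3) < k) {m : ℕ}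
    (hm : 0 < m) (r : ℕ) :
    3 * m * t ≤ SimpleGraph.planarTuranNumber (1 + r + m * t) (SimpleGraph.cycleGraph k)
      + 3 * m := by
  obtain ⟨K, A, hK, hA, h3, hc, hV, hE, hcard⟩ := h m r hm
  obtain ⟨K', hK', hc', hV', hE'⟩ := hK.exists_iterate_subdivide j hA h3 (by omega) hc
  have hpow : 0 < 2 ^ j := by positivity
  have := hK'.card_edges_le_planarTuranNumber (by nlinarith) hk hc'
  rw [hV, hcard] at hV'
  rw [hE, hcard] at hE'
  -- Here `t` counts the vertices of a finished block other than the origin; such a block has `3 *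
  -- (t + 1) - 6 = 3 * t - 3` edges.
  have e1 : (K'.filter (fun s => s.card = 1)).card = 1 + r + m * t := by
    have : 2 * (m * t) = m * ((2 * s + 1) * 3 ^ j + 3) := by rw [← ht]; ring
    nlinarith
  have e2 : (K'.filter (fun s => s.card = 2)).card + 3 * m = 3 * m * t := by
    have : 2 * (3 * m * t) = 3 * m * ((2 * s + 1) * 3 ^ j + 3) := by rw [← ht]; ring
    nlinarith
  rw [e1] at this
  omega

lemma HasBlocks.eventually_le {s : ℕ} (h : HasBlocks (EuclideanSpace ℝ (Fin 2)) s)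
    {j k : ℕ} (hk : 2 ^ j * (s + 3) < k) {c : ℝ}
    (hc : 6 < c * ((2 * s + 1) * 3 ^ j + 3)) :
    ∀ᶠ n : ℕ in Filter.atTop, (3 : ℝ) * n - 6 - c * n ≤
      SimpleGraph.planarTuranNumber n (SimpleGraph.cycleGraph k) := by
  obtain ⟨t, ht⟩ : ∃ t, 2 * t = (2 * s + 1) * 3 ^ j + 3 := by
    have h1 : Odd ((2 * s + 1) * 3 ^ j) := by
      rw [Nat.odd_mul]
      exact ⟨⟨s, rfl⟩, Odd.pow (by decide)⟩
    obtain ⟨u, hu⟩ := h1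
    exact ⟨u + 2, by omega⟩
  have htR : 2 * (t : ℝ) = (2 * s + 1) * 3 ^ j + 3 := by exact_mod_cast ht
  have ht0 : 0 < t := by omega
  have ht0' : (0 : ℝ) < t := by exact_mod_cast ht0
  have hct : 0 < c * t - 3 := by rw [← htR] at hc; linarith
  -- The first threshold gives at least one block. The second makes the strict surplus `(c * t - 3)
  -- * n` absorb the `3 * t ^ 2` that the fewer than `t` isolated vertices cost.
  filter_upwards [Filter.eventually_ge_atTop (t + 1),
    Filter.eventually_ge_atTop ⌈3 * (t : ℝ) ^ 2 / (c * t - 3)⌉₊] with n hn hn'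
  have hn'' := (div_le_iff₀ hct).1 (Nat.ceil_le.1 hn')
  have hdiv := Nat.div_add_mod (n - 1) t
  have hmod := Nat.mod_lt (n - 1) ht0
  set m := (n - 1) / t
  set r := (n - 1) % t
  have hm : 0 < m := Nat.div_pos (by omega) ht0
  have hn_eq : 1 + r + m * t = n := by
    rw [mul_comm m t]
    omega
  have key := h.le_planarTuranNumber ht hk hm r
  rw [hn_eq] at key
  have key' : 3 * (m : ℝ) * t
      ≤ SimpleGraph.planarTuranNumber n (SimpleGraph.cycleGraph k) + 3 * m := by
    exact_mod_cast key
  have hnR : (1 : ℝ) + r + m * t = n := by exact_mod_cast hn_eq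
  have hrR : (r : ℝ) ≤ t := by exact_mod_cast hmod.le
  have hr0 : (0 : ℝ) ≤ r := by positivity
  have hfinal : 3 * (r : ℝ) + 3 * m ≤ 3 + c * n := by
    refine le_of_mul_le_mul_right ?_ ht0'
    nlinarith
  linarith

end StraightLineComplex

/-! ### Estimates with the exponent `log₂ 3` and the choice of parameters -/

lemma natCast_rpow_logb_le {k a j : ℕ} (h : k ≤ a * 2 ^ j) :
    (k : ℝ) ^ Real.logb 2 3 ≤ (a : ℝ) ^ Real.logb 2 3 * 3 ^ j := by
  have hL : 0 ≤ Real.logb 2 3 := Real.logb_nonneg (by norm_num) (by norm_num)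
  have h2 : ((2 : ℝ) ^ j) ^ Real.logb 2 3 = 3 ^ j := by
    rw [← Real.rpow_natCast, ← Real.rpow_mul (by norm_num), mul_comm, Real.rpow_mul (by norm_num),
      Real.rpow_logb (by norm_num) (by norm_num) (by norm_num), Real.rpow_natCast]
  rw [← h2, ← Real.mul_rpow (by positivity) (by positivity)]
  exact Real.rpow_le_rpow (by positivity) (by exact_mod_cast h) hL

/-- From `2 ^ 11 < 3 ^ 7` the exponent is at least `11 / 7`, and `(27 / 5) ^ 7 < 3 ^ 11`. -/
lemma lt_three_rpow_logb : (27 : ℝ) / 5 < 3 ^ Real.logb 2 3 := by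
  have h7 : (11 : ℝ) ≤ 7 * Real.logb 2 3 := by
    have : (7 : ℝ) * Real.logb 2 3 = Real.logb 2 (3 ^ 7) := by
      rw [Real.logb_pow]
      norm_num
    rw [this, Real.le_logb_iff_rpow_le (by norm_num) (by norm_num)]
    norm_num
  by_contra! h
  have h1 := pow_le_pow_left₀ (by positivity) h 7
  rw [← Real.rpow_natCast, ← Real.rpow_mul (by norm_num)] at h1
  have h2 : (3 : ℝ) ^ (11 : ℝ) ≤ 3 ^ (Real.logb 2 3 * (7 : ℕ)) :=
    Real.rpow_le_rpow_of_exponent_le (by norm_num) (by push_cast; linarith)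
  norm_num at h1 h2
  linarith

theorem theorem2 (k : ℕ) (hk : 7 ≤ k) :
    ∀ᶠ n : ℕ in Filter.atTop,
      (3 : ℝ) * (n : ℝ) - 6
          - 6 * (3 : ℝ) ^ Real.logb 2 3 * (n : ℝ) / (k : ℝ) ^ Real.logb 2 3
        ≤ (SimpleGraph.planarTuranNumber n (SimpleGraph.cycleGraph k) : ℝ) := by
  obtain ⟨j, hj1, hj2⟩ : ∃ j, 4 * 2 ^ j < k ∧ k ≤ 8 * 2 ^ j := by
    have hex : ∃ j, k ≤ 8 * 2 ^ j := ⟨k, by have := Nat.lt_two_pow_self (n := k); omega⟩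
    -- The least such `j` works: minimality gives the lower bound when `j > 0`, and `7 ≤ k` gives it
    -- when `j = 0`.
    refine ⟨Nat.find hex, ?_, Nat.find_spec hex⟩
    rcases h : Nat.find hex with _ | i
    · omega
    · have := Nat.find_min hex (m := i) (by omega)
      rw [pow_succ]
      omega
  let φ : EuclideanSpace ℝ (Fin 2) ≃ₗ[ℝ] ℝ × ℝ :=
    (WithLp.linearEquiv 2 ℝ (Fin 2 → ℝ)).trans (LinearEquiv.finTwoArrow ℝ ℝ)
  have hk0 : (0 : ℝ) < (k : ℝ) ^ Real.logb 2 3 :=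
    Real.rpow_pos_of_pos (by exact_mod_cast (by omega : 0 < k)) _
  have h3 : (0 : ℝ) < (3 : ℝ) ^ Real.logb 2 3 := by positivity
  have hreorder : ∀ n : ℕ, 6 * (3 : ℝ) ^ Real.logb 2 3 * (n : ℝ) / (k : ℝ) ^ Real.logb 2 3
      = 6 * (3 : ℝ) ^ Real.logb 2 3 / (k : ℝ) ^ Real.logb 2 3 * n := fun n => by ring
  simp only [hreorder]
  -- Four-vertex blocks need `4 * 2 ^ j < k` and reach up to `k = 3 * 2 ^ (j + 1)`, where the `+ 3`
  -- in `2 * t` gives strictness. Beyond that there is room for five-vertex blocks, which suffice up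
  -- to `8 * 2 ^ j` because `27 < 5 * 3 ^ log₂ 3`.
  by_cases h6 : k ≤ 6 * 2 ^ j
  · refine (StraightLineComplex.hasBlocks_one φ).eventually_le (j := j) (by omega) ?_
    have := natCast_rpow_logb_le (k := k) (a := 3) (j := j + 1) (by rw [pow_succ]; omega)
    rw [div_mul_eq_mul_div, lt_div_iff₀ hk0]
    push_cast at this ⊢
    rw [pow_succ] at this
    nlinarith
  · refine (StraightLineComplex.hasBlocks_two φ).eventually_le (j := j) (by omega) ?_
    have := natCast_rpow_logb_le (k := k) (a := 8) (j := j) hj2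
    have h8 : ((8 : ℕ) : ℝ) ^ Real.logb 2 3 = 27 := by
      rw [show ((8 : ℕ) : ℝ) = 2 ^ (3 : ℝ) by norm_num, ← Real.rpow_mul (by norm_num), mul_comm,
        Real.rpow_mul (by norm_num), Real.rpow_logb (by norm_num) (by norm_num) (by norm_num)]
      norm_num
    rw [h8] at this
    rw [div_mul_eq_mul_div, lt_div_iff₀ hk0]
    have h5 := mul_lt_mul_of_pos_right lt_three_rpow_logb (by positivity : (0 : ℝ) < 3 ^ j)
    push_cast
    nlinarith
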